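/- Let $V=\{1,\dots,d\}$, let $G,H:2^V\to\mathbb R$ be submodular with $G(\emptyset)=H(\emptyset)=0$, let $F=G-H$, $F^\star=\min_{X\subseteq V}F(X)$, and let $g_L,h_L$ be the Lovász extensions of $G,H$. For $\rho\ge 0$ put $$g=g_L+\delta_{[0,1]^d}+\tfrac{\rho}{2}\|\cdot\|^2,\qquad h=h_L+\tfrac{\rho}{2}\|\cdot\|^2,\qquad f=g-h .$$ Here $\|\cdot\|$ is the Euclidean norm, $\delta_{[0,1]^d}$ is $0$ on $[0,1]^d$ and $+\infty$ elsewhere, $\Phi^*$ is the Fenchel conjugate, $\partial_\epsilon\Phi(x)=\{y:\Phi(z)\ge\Phi(x)+\langle y,z-x\rangle-\epsilon\ \ \forall z\in\mathbb R^d\}$ for $x$ with $\Phi(x)<+\infty$, and $\partial=\partial_0$. A point $x$ is an $(\epsilon_1,\epsilon_2)$-critical point of $g-h$ if $\partial_{\epsilon_1}g(x)\cap\partial_{\epsilon_2}h(x)\ne\emptyset$, and an $\epsilon$-strong critical point of $g-h$ if $\partial h(x)\subseteq\partial_\epsilon g(x)$. A set $X\subseteq V$ is an $\epsilon$-strong local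 minimum of $F$ if $F(X)\le F(Y)+\epsilon$ for all $Y\subseteq X$ and all $Y\supseteq X$. For $x\in\mathbb R^d$ and a permutation $\sigma$ with $x_{\sigma(1)}\ge\dots\ge x_{\sigma(d)}$, $\mathrm{Round}_F(x)$ is a set of least $F$-value among $\{\sigma(1),\dots,\sigma(k)\}$, $k=0,\dots,d$. Let $\epsilon_x\ge 0$ and let the sequences be generated by approximate CDCAR: $X^0\subseteq V$ is arbitrary and, for all $k\ge 0$, $$x^k=\mathbb 1_{X^k},\quad y^k\in\mathop{\rm argmin}\{h^*(y)-g^*(y):y\in\partial h(x^k)\},\quad \tilde x^{k+1}\in\partial_{\epsilon_x}g^*(y^k),\quad X^{k+1}=\mathrm{Round}_F(\tilde x^{k+1}).$$ For $\Phi\in\{g,h\}$ write $T_\Phi(\tilde x^{k+1})=\Phi(x^k)-\Phi(\tilde x^{k+1})-\langle y^k,x^k-\tilde x^{k+1}\rangle$. Then for all $t\in(0,1]$, $k\in\mathbb N$ and $\epsilon\ge 0$: (a) $T_g(\tilde x^{k+1})\ge\frac{\rho(1-t)}{2}\|x^k-\tilde x^{k+1}\|^2-\frac{\epsilon_x}{t}$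 and $T_h(\tilde x^{k+1})\le-\frac{\rho}{2}\|x^k-\tilde x^{k+1}\|^2$. If $T_g(\tilde x^{k+1})\le\epsilon$, then $x^k$ is an $(\epsilon+\epsilon_x,0)$-critical point of $g-h$ with $y^k\in\partial_{\epsilon+\epsilon_x}g(x^k)\cap\partial h(x^k)$, and $\frac{\rho(1-t)}{2}\|x^k-\tilde x^{k+1}\|^2\le\frac{\epsilon_x}{t}+\epsilon$; conversely, if $x^k\in\partial_{\epsilon+\epsilon_x}g^*(y^k)$, then $T_g(\tilde x^{k+1})\le\epsilon_x+\epsilon$. If $T_h(\tilde x^{k+1})\ge-\epsilon$, then $\tilde x^{k+1}$ is an $(\epsilon_x,\epsilon)$-critical point of $g-h$ with $y^k\in\partial_{\epsilon_x}g(\tilde x^{k+1})\cap\partial_\epsilon h(\tilde x^{k+1})$, and $\frac{\rho}{2}\|x^k-\tilde x^{k+1}\|^2\le\epsilon$; conversely, if $y^k\in\partial_\epsilon h(\tilde x^{k+1})$, then $T_h(\tilde x^{k+1})\ge-\epsilon$. (b) $F(X^k)-F(X^{k+1})\ge f(x^k)-f(\tilde x^{k+1})=T_g(\tilde x^{k+1})-T_h(\tilde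 x^{k+1})\ge\frac{\rho(2-t)}{2}\|x^k-\tilde x^{k+1}\|^2-\frac{\epsilon_x}{t}$. (c) If $F(X^k)-F(X^{k+1})\le\epsilon$, then $f(x^k)-f(\tilde x^{k+1})=T_g(\tilde x^{k+1})-T_h(\tilde x^{k+1})\le\epsilon$, there are $\epsilon_1\ge-\epsilon_x$ and $\epsilon_2\ge0$ with $\epsilon_1+\epsilon_2=\epsilon$ such that $x^k$ is an $(\epsilon_x+\epsilon_1,0)$-critical point of $g-h$ with $y^k\in\partial_{\epsilon_x+\epsilon_1}g(x^k)\cap\partial h(x^k)$ and $\tilde x^{k+1}$ is an $(\epsilon_x,\epsilon_2)$-critical point of $g-h$ with $y^k\in\partial_{\epsilon_x}g(\tilde x^{k+1})\cap\partial_{\epsilon_2}h(\tilde x^{k+1})$, and $\frac{\rho(2-t)}{2}\|x^k-\tilde x^{k+1}\|^2\le\epsilon+\frac{\epsilon_x}{t}$. Conversely, if $\epsilon_1+\epsilon_2=\epsilon$, $\epsilon_1\ge-\epsilon_x$, $\epsilon_2\ge0$, $x^k\in\partial_{\epsilon_x+\epsilon_1}g^*(y^k)$ and $y^k\in\partial_{\epsilon_2}h(\tilde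 x^{k+1})$, then $T_g(\tilde x^{k+1})-T_h(\tilde x^{k+1})\le\epsilon_x+\epsilon$ and $f(x^k)-f(\tilde x^{k+1})\le\epsilon_x+\epsilon$. (d) For every $K\ge1$, $\min_{k<K}\bigl(T_g(\tilde x^{k+1})-T_h(\tilde x^{k+1})\bigr)=\min_{k<K}\bigl(f(x^k)-f(\tilde x^{k+1})\bigr)\le\min_{k<K}\bigl(F(X^k)-F(X^{k+1})\bigr)\le\frac{F(X^0)-F^\star}{K}$. (e) If $\rho>0$, then for every $K\ge1$, $\min_{k<K}\|x^k-\tilde x^{k+1}\|\le\sqrt{\frac{2}{\rho(2-t)}\Bigl(\frac{F(X^0)-F^\star}{K}+\frac{\epsilon_x}{t}\Bigr)}$. In addition, if $F(X^k)-F(X^{k+1})\le\epsilon$, then $x^k$ is an $(\epsilon+\epsilon_x)$-strong critical point of $g-h$, and $X^k$ is an $\epsilon'$-strong local minimum of $F$, where $$\epsilon'=\begin{cases}\sqrt{2\rho d(\epsilon+\epsilon_x)}&\text{if }\epsilon+\epsilon_x\le\frac{\rho d}{2},\\ \frac{\rho d}{2}+\epsilon+\epsilon_x&\text{otherwise.}\end{cases}$$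 Finally, if $\epsilon>0$, the first $k$ with $F(X^k)-F(X^{k+1})\le\epsilon$ exists and satisfies $k\le(F(X^0)-F^\star)/\epsilon$; at that $k$, $X^k$ is an $\epsilon'$-strong local minimum of $F$. -/

import Mathlib

noncomputable section

namespace DSMin

/-- The space `ℝ^d` with the Euclidean norm and inner product. -/
abbrev E (d : ℕ) := EuclideanSpace ℝ (Fin d)

/-! ### Set functions on the ground set `V = Fin d` -/

/-- The marginal gain `F(i | X) = F(X ∪ {i}) - F(X)`. -/
def marginal {d : ℕ} (F : Finset (Fin d) → ℝ) (i : Fin d) (X : Finset (Fin d)) : ℝ :=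
  F (insert i X) - F X

/-- `F` is normalized: `F(∅) = 0`. -/
def Normalized {d : ℕ} (F : Finset (Fin d) → ℝ) : Prop := F ∅ = 0

/-- `F` is submodular: it has diminishing marginal gains. -/
def Submodular {d : ℕ} (F : Finset (Fin d) → ℝ) : Prop :=
  ∀ X Y : Finset (Fin d), X ⊆ Y → ∀ i, i ∉ Y → marginal F i Y ≤ marginal F i X

/-- The minimum `F^⋆` of `F` over all subsets of the ground set. -/
def minVal {d : ℕ} (F : Finset (Fin d) → ℝ) : ℝ :=
  Finset.univ.inf' Finset.univ_nonempty F

/-- `X` is an `ε`-strong local minimum of `F`. -/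
def IsStrongLocalMin {d : ℕ} (F : Finset (Fin d) → ℝ) (ε : ℝ) (X : Finset (Fin d)) : Prop :=
  (∀ Y, Y ⊆ X → F X ≤ F Y + ε) ∧ (∀ Y, X ⊆ Y → F X ≤ F Y + ε)

/-- The indicator vector `𝟙_X ∈ ℝ^d`. -/
def indVec {d : ℕ} (X : Finset (Fin d)) : E d :=
  WithLp.toLp 2 fun i => if i ∈ X then 1 else 0

/-- `σ` is a decreasing order of `x`: `x_{σ(1)} ≥ ⋯ ≥ x_{σ(d)}`. -/
def IsDecreasingOrder {d : ℕ} (x : E d) (σ : Equiv.Perm (Fin d)) : Prop :=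
  ∀ i j : Fin d, i ≤ j → x (σ j) ≤ x (σ i)

/-- The set `S^σ_k` of the first `k` elements in the order `σ`; `S^σ_0 = ∅`. -/
def prefixSet {d : ℕ} (σ : Equiv.Perm (Fin d)) (k : ℕ) : Finset (Fin d) :=
  (Finset.univ.filter fun j : Fin d => (j : ℕ) < k).image σ

/-- A decreasing order of `x`. -/
def decOrder {d : ℕ} (x : E d) : Equiv.Perm (Fin d) := Tuple.sort fun i => -x i

theorem isDecreasingOrder_decOrder {d : ℕ} (x : E d) : IsDecreasingOrder x (decOrder x) := by
  intro i j hij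
  have h := Tuple.monotone_sort (fun i => -x i) hij
  simpa [decOrder] using h

/-- The Lovász extension `f_L(x) = ∑_k x_{σ(k)} F(σ(k) | S^σ_{k-1})`, for a decreasing order `σ`
of `x` (the value does not depend on which one). Positions are numbered from `0`, so the elements
that come before position `k` form `S^σ_k`. -/
def lovasz {d : ℕ} (F : Finset (Fin d) → ℝ) (x : E d) : ℝ :=
  ∑ k : Fin d, x (decOrder x k) * marginal F (decOrder x k) (prefixSet (decOrder x) k)

/-- `X` is a result of the operation `Round_F(x)`: a best set `S^σ_k`, `0 ≤ k ≤ d`, for some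
decreasing order `σ` of `x`. -/
def IsRound {d : ℕ} (F : Finset (Fin d) → ℝ) (x : E d) (X : Finset (Fin d)) : Prop :=
  ∃ σ : Equiv.Perm (Fin d), IsDecreasingOrder x σ ∧
    ∃ k : ℕ, k ≤ d ∧ X = prefixSet σ k ∧ ∀ j : ℕ, j ≤ d → F (prefixSet σ k) ≤ F (prefixSet σ j)

/-! ### Extended-real-valued functions on `ℝ^d` -/

/-- The Fenchel conjugate `Φ^*(y) = sup_x ⟨x, y⟩ - Φ(x)`. -/
def conj {d : ℕ} (Φ : E d → EReal) (y : E d) : EReal :=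
  ⨆ x : E d, ((inner ℝ x y : ℝ) : EReal) - Φ x

/-- The `ε`-subdifferential `∂_ε Φ(x)`; it is empty at points outside the domain of `Φ`. -/
def subdiff {d : ℕ} (ε : ℝ) (Φ : E d → EReal) (x : E d) : Set (E d) :=
  {y | Φ x ≠ ⊤ ∧ ∀ z : E d, Φ x + ((inner ℝ y (z - x) - ε : ℝ) : EReal) ≤ Φ z}

/-- `x` is an `(ε₁, ε₂)`-critical point of `g - h`. -/
def IsCritical {d : ℕ} (g h : E d → EReal) (ε₁ ε₂ : ℝ) (x : E d) : Prop :=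
  (subdiff ε₁ g x ∩ subdiff ε₂ h x).Nonempty

/-- `x` is an `ε`-strong critical point of `g - h`. -/
def IsStrongCritical {d : ℕ} (g h : E d → EReal) (ε : ℝ) (x : E d) : Prop :=
  subdiff 0 h x ⊆ subdiff ε g x

/-- `T_Φ = Φ(x) - Φ(x') - ⟨y, x - x'⟩`, for consecutive iterates `x`, `x'` and a dual
iterate `y`. -/
def gapT {d : ℕ} (Φ : E d → EReal) (y x x' : E d) : EReal :=
  Φ x - Φ x' - ((inner ℝ y (x - x') : ℝ) : EReal)

/-! ### The DC program of a difference of submodular functions -/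

/-- The indicator function `δ_{[0,1]^d}`. -/
def boxInd {d : ℕ} (x : E d) : EReal :=
  open Classical in if ∀ i, 0 ≤ x i ∧ x i ≤ 1 then 0 else ⊤

/-- `g = g_L + δ_{[0,1]^d} + (ρ/2) ‖·‖²`. -/
def gFun {d : ℕ} (G : Finset (Fin d) → ℝ) (ρ : ℝ) (x : E d) : EReal :=
  (lovasz G x : EReal) + boxInd x + ((ρ / 2 * ‖x‖ ^ 2 : ℝ) : EReal)

/-- `h = h_L + (ρ/2) ‖·‖²`. -/
def hFun {d : ℕ} (H : Finset (Fin d) → ℝ) (ρ : ℝ) (x : E d) : EReal :=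
  (lovasz H x : EReal) + ((ρ / 2 * ‖x‖ ^ 2 : ℝ) : EReal)

/-- The DC objective `f = g - h`. -/
def fFun {d : ℕ} (G H : Finset (Fin d) → ℝ) (ρ : ℝ) (x : E d) : EReal :=
  gFun G ρ x - hFun H ρ x

/-- The sequences `x^k`, `X^k`, `x̃^k` (only `k ≥ 1` matters) and `y^k` are generated by
approximate CDCA with rounding, with accuracy `εx`, for `F = G - H`: starting from an arbitrary
integral point, `y^k` minimizes the dual objective `h^* - g^*` over `∂h(x^k)`, `x̃^{k+1}` is any
point of `∂_{εx} g^*(y^k)`, and `x^{k+1}` is the indicator vector of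
`X^{k+1} = Round_F(x̃^{k+1})`. -/
structure IsCDCAR {d : ℕ} (G H : Finset (Fin d) → ℝ) (ρ εx : ℝ)
    (x : ℕ → E d) (X : ℕ → Finset (Fin d)) (xt y : ℕ → E d) : Prop where
  x_eq : ∀ k, x k = indVec (X k)
  y_mem : ∀ k, y k ∈ subdiff 0 (hFun H ρ) (x k)
  y_min : ∀ k, ∀ z ∈ subdiff 0 (hFun H ρ) (x k),
    conj (hFun H ρ) (y k) - conj (gFun G ρ) (y k) ≤ conj (hFun H ρ) z - conj (gFun G ρ) z
  xt_mem : ∀ k, xt (k + 1) ∈ subdiff εx (conj (gFun G ρ)) (y k)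
  round : ∀ k, IsRound (G - H) (xt (k + 1)) (X (k + 1))

/-- The accuracy `ε'` as a function of `ρ`, `d` and `ε` (to be used at `ε + εx`). -/
def epsPrime (ρ : ℝ) (d : ℕ) (ε : ℝ) : ℝ :=
  if ε ≤ ρ * d / 2 then √(2 * ρ * d * ε) else ρ * d / 2 + ε

end DSMin

end

open DSMin

/-!
On the cube every function involved is real-valued, and everything follows from explicit subgradients
of the Lovász extension. For a permutation `σ`, the greedy vector of a submodular `F` lies in the base
polytope, so by summation by parts `⟨greedy F σ, x⟩ ≤ F_L(x)`, with equality if `σ` is a decreasing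
order of `x` (`inner_greedy_le`). Hence `F_L` is a maximum of linear functions: it is convex, it
extends `F`, and the two components `g` and `h` are `ρ`-strongly convex.

The same summation by parts shows that rounding does not increase the objective
(`IsRound.le_lovasz`). For the dual iterates, `x̃ ∈ ∂_ε g^*(y)` is turned into `y ∈ ∂_ε g(x̃)`
(`mem_subdiff_of_mem_subdiff_conj`): the greedy subgradients give `g ≤ g^{**}` on the cube, and the
linear growth of `g^*` shows that `x̃` is in the cube. The bounds on `T_g` and `T_h` are then strong
convexity along the segment between consecutive iterates (`growth_of_segment`), the statements on
critical points are rearrangements of subgradient inequalities, and the rates follow by telescoping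
`F(X^k) - F(X^{k+1})`.

Minimality of `y^k` in the dual objective makes all of `∂h(x^k)` consist of approximate subgradients
of `g` as soon as `y^k` is one (`isStrongCritical_of_isMin`). If `Y` is comparable with `X = X^k`,
some permutation has both as prefixes, and its greedy vector for `H` yields a subgradient of `h` at
`𝟙_X` whose `h_L`-part is exact at `𝟙_Y`. Testing it as a subgradient of `g` at `𝟙_X + τ (𝟙_Y - 𝟙_X)`
gives `F(X) ≤ F(Y) + ρ d τ / 2 + ε / τ` for all `τ ∈ (0, 1]`, and optimizing over `τ` gives `ε'`.
-/

open DSMin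

namespace DSMin

variable {d : ℕ}

/-! ### Greedy vectors and the Lovász extension -/

theorem inner_eq_sum (x y : E d) : inner ℝ x y = ∑ i, x i * y i := by
  simp [PiLp.inner_apply, mul_comm]

theorem mem_prefixSet {σ : Equiv.Perm (Fin d)} {k : ℕ} {i : Fin d} :
    i ∈ prefixSet σ k ↔ (σ.symm i : ℕ) < k := by
  simp only [prefixSet, Finset.mem_image, Finset.mem_filter, Finset.mem_univ, true_and]
  constructor
  · rintro ⟨j, hj, rfl⟩
    simpa using hj
  · intro h
    exact ⟨σ.symm i, h, by simp⟩

theorem prefixSet_zero (σ : Equiv.Perm (Fin d)) : prefixSet σ 0 = ∅ := by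
  ext i; simp [mem_prefixSet]

theorem prefixSet_self (σ : Equiv.Perm (Fin d)) : prefixSet σ d = Finset.univ := by
  ext i; simp [mem_prefixSet]

theorem prefixSet_succ (σ : Equiv.Perm (Fin d)) (k : Fin d) :
    prefixSet σ (k + 1) = insert (σ k) (prefixSet σ k) := by
  ext i
  rw [Finset.mem_insert, mem_prefixSet, mem_prefixSet, ← Equiv.symm_apply_eq, Fin.ext_iff]
  omega

theorem notMem_prefixSet (σ : Equiv.Perm (Fin d)) (k : Fin d) : σ k ∉ prefixSet σ k := by
  simp [mem_prefixSet]

/-- The superlevel sets of `w` are prefixes of every decreasing order of `w`. -/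
theorem exists_prefixSet_eq {w : E d} {σ : Equiv.Perm (Fin d)} (hσ : IsDecreasingOrder w σ)
    {A : Finset (Fin d)} (c : ℝ) (hA : ∀ i, i ∈ A ↔ c < w i) :
    ∃ k, k ≤ d ∧ A = prefixSet σ k := by
  refine ⟨A.sup fun i => (σ.symm i : ℕ) + 1, Finset.sup_le fun i _ => (σ.symm i).2, ?_⟩
  ext i
  rw [mem_prefixSet, Finset.lt_sup_iff]
  constructor
  · exact fun h => ⟨i, h, Nat.lt_succ_self _⟩
  · rintro ⟨j, hj, hij⟩
    have h := hσ (σ.symm i) (σ.symm j) (Fin.le_def.2 (Nat.lt_succ_iff.1 hij))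
    rw [Equiv.apply_symm_apply, Equiv.apply_symm_apply] at h
    exact (hA i).2 (((hA j).1 hj).trans_le h)

/-- The greedy vector of `F` for the order `σ`: its coordinate at `σ k` is the gain from adding
`σ k` to its predecessors. If `F` is submodular and normalized, these are the vertices of the base
polytope. -/
noncomputable def greedy (F : Finset (Fin d) → ℝ) (σ : Equiv.Perm (Fin d)) : E d :=
  WithLp.toLp 2 fun i => marginal F i (prefixSet σ (σ.symm i))

theorem greedy_apply (F : Finset (Fin d) → ℝ) (σ : Equiv.Perm (Fin d)) (k : Fin d) :
    greedy F σ (σ k) = marginal F (σ k) (prefixSet σ k) := by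
  simp [greedy]

theorem inner_greedy (F : Finset (Fin d) → ℝ) (σ : Equiv.Perm (Fin d)) (x : E d) :
    inner ℝ (greedy F σ) x = ∑ k : Fin d, x (σ k) * marginal F (σ k) (prefixSet σ k) := by
  rw [inner_eq_sum, ← Equiv.sum_comp σ]
  exact Finset.sum_congr rfl fun k _ => by rw [greedy_apply, mul_comm]

theorem lovasz_eq_inner (F : Finset (Fin d) → ℝ) (x : E d) :
    lovasz F x = inner ℝ (greedy F (decOrder x)) x := (inner_greedy _ _ _).symm

theorem sum_greedy_prefixSet {F : Finset (Fin d) → ℝ} (hF : Normalized F)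
    (σ : Equiv.Perm (Fin d)) {k : ℕ} (hk : k ≤ d) :
    ∑ i ∈ prefixSet σ k, greedy F σ i = F (prefixSet σ k) := by
  induction k with
  | zero => rw [prefixSet_zero, Finset.sum_empty, hF]
  | succ k ih =>
    have h := prefixSet_succ σ ⟨k, hk⟩
    have h' := notMem_prefixSet σ ⟨k, hk⟩
    simp only at h h'
    have h3 : greedy F σ (σ ⟨k, hk⟩) = _ := greedy_apply F σ ⟨k, hk⟩
    rw [h, Finset.sum_insert h', ih (by omega), h3, marginal]
    ring

/-- Greedy vectors of submodular functions lie in the base polytope. -/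
theorem sum_greedy_le {F : Finset (Fin d) → ℝ} (hF : Normalized F) (hFs : Submodular F)
    (σ : Equiv.Perm (Fin d)) (A : Finset (Fin d)) : ∑ i ∈ A, greedy F σ i ≤ F A := by
  have key : ∀ k ≤ d, ∑ i ∈ A ∩ prefixSet σ k, greedy F σ i ≤ F (A ∩ prefixSet σ k) := by
    intro k hk
    induction k with
    | zero => rw [prefixSet_zero, Finset.inter_empty, Finset.sum_empty, hF]
    | succ k ih =>
      have h := prefixSet_succ σ ⟨k, hk⟩
      have h' := notMem_prefixSet σ ⟨k, hk⟩
      simp only at h h'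
      have h3 : greedy F σ (σ ⟨k, hk⟩) = _ := greedy_apply F σ ⟨k, hk⟩
      have ih := ih (by omega)
      rw [h]
      by_cases hA : σ ⟨k, hk⟩ ∈ A
      · rw [Finset.inter_insert_of_mem hA,
          Finset.sum_insert fun hm => h' (Finset.mem_inter.1 hm).2, h3]
        have := hFs _ _ (Finset.inter_subset_right (s₁ := A) (s₂ := prefixSet σ k)) _ h'
        simp only [marginal] at this ⊢
        linarith
      · rw [Finset.inter_insert_of_notMem hA]
        exact ih
  have := key d le_rfl
  rwa [prefixSet_self, Finset.inter_univ] at this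

/-- An inequality form of summation by parts for an antitone sequence `a` with values between `c`
and `C`. -/
theorem le_sum_mul_sub {n : ℕ} (a : Fin n → ℝ) (ha : ∀ i j, i ≤ j → a j ≤ a i) (D : ℕ → ℝ)
    (hD : ∀ k ≤ n, 0 ≤ D k) {c C : ℝ} (hcC : c ≤ C) (hc : ∀ i, c ≤ a i) (hC : ∀ i, a i ≤ C) :
    c * D n - C * D 0 ≤ ∑ k : Fin n, a k * (D (k + 1) - D k) := by
  induction n generalizing c with
  | zero =>
    have := mul_le_mul_of_nonneg_right hcC (hD 0 le_rfl)
    simpa using this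
  | succ n ih =>
    rw [Fin.sum_univ_castSucc]
    have h := ih (fun i => a i.castSucc) (fun i j hij => ha _ _ (by simpa using hij))
      (fun k hk => hD k (by omega)) (hC (Fin.last n)) (fun i => ha _ _ (Fin.le_last _))
      (fun i => hC _)
    have h' := mul_le_mul_of_nonneg_right (hc (Fin.last n)) (hD (n + 1) le_rfl)
    simp only [Fin.val_castSucc, Fin.val_last] at h ⊢
    linarith

/-- Edmonds' theorem: a decreasing order of `x` gives a greedy vector that maximizes `⟨·, x⟩` among
all greedy vectors. -/
theorem inner_greedy_le {F : Finset (Fin d) → ℝ} (hF : Normalized F) (hFs : Submodular F)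
    {x : E d} {τ : Equiv.Perm (Fin d)} (hτ : IsDecreasingOrder x τ) (σ : Equiv.Perm (Fin d)) :
    inner ℝ (greedy F σ) x ≤ inner ℝ (greedy F τ) x := by
  have hb : ∀ i, |x i| ≤ ‖x‖ := fun i => PiLp.norm_apply_le x i
  have h := le_sum_mul_sub (fun k => x (τ k)) hτ
    (fun k => F (prefixSet τ k) - ∑ i ∈ prefixSet τ k, greedy F σ i)
    (fun k _ => sub_nonneg.2 (sum_greedy_le hF hFs σ _))
    (neg_le_self (norm_nonneg x)) (fun i => (abs_le.1 (hb _)).1) (fun i => (abs_le.1 (hb _)).2)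
  have h0 : F ∅ = 0 := hF
  have h1 : ∑ i, greedy F σ i = F Finset.univ := by
    simpa [prefixSet_self] using sum_greedy_prefixSet hF σ le_rfl
  simp only [prefixSet_zero, prefixSet_self, h0, h1, Finset.sum_empty, sub_self, mul_zero] at h
  have h2 : ∑ k : Fin d, x (τ k) * ((F (prefixSet τ (k + 1)) -
      ∑ i ∈ prefixSet τ (k + 1), greedy F σ i) -
        (F (prefixSet τ k) - ∑ i ∈ prefixSet τ k, greedy F σ i))
      = inner ℝ (greedy F τ) x - inner ℝ (greedy F σ) x := by
    rw [inner_greedy, inner_eq_sum (greedy F σ), ← Equiv.sum_comp τ fun i => greedy F σ i * x i,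
      ← Finset.sum_sub_distrib]
    refine Finset.sum_congr rfl fun k _ => ?_
    rw [prefixSet_succ, Finset.sum_insert (notMem_prefixSet τ k), marginal]
    ring
  rw [h2] at h
  linarith

theorem inner_greedy_le_lovasz {F : Finset (Fin d) → ℝ} (hF : Normalized F) (hFs : Submodular F)
    (σ : Equiv.Perm (Fin d)) (x : E d) : inner ℝ (greedy F σ) x ≤ lovasz F x := by
  rw [lovasz_eq_inner]
  exact inner_greedy_le hF hFs (isDecreasingOrder_decOrder x) σ

/-- The value of the Lovász extension may be computed with any decreasing order. -/
theorem inner_greedy_eq_lovasz {F : Finset (Fin d) → ℝ} (hF : Normalized F) (hFs : Submodular F)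
    {x : E d} {σ : Equiv.Perm (Fin d)} (hσ : IsDecreasingOrder x σ) :
    inner ℝ (greedy F σ) x = lovasz F x := by
  refine le_antisymm (inner_greedy_le_lovasz hF hFs σ x) ?_
  rw [lovasz_eq_inner]
  exact inner_greedy_le hF hFs hσ _

theorem lovasz_convex {F : Finset (Fin d) → ℝ} (hF : Normalized F) (hFs : Submodular F)
    (x z : E d) {t : ℝ} (ht : 0 ≤ t) (ht' : t ≤ 1) :
    lovasz F (x + t • (z - x)) ≤ (1 - t) * lovasz F x + t * lovasz F z := by
  set s := greedy F (decOrder (x + t • (z - x))) with hs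
  have hx := mul_le_mul_of_nonneg_left (inner_greedy_le_lovasz hF hFs _ x : inner ℝ s x ≤ _)
    (sub_nonneg.2 ht')
  have hz := mul_le_mul_of_nonneg_left (inner_greedy_le_lovasz hF hFs _ z : inner ℝ s z ≤ _) ht
  rw [lovasz_eq_inner, ← hs, inner_add_right, inner_smul_right, inner_sub_right]
  linarith

theorem inner_indVec (s : E d) (X : Finset (Fin d)) : inner ℝ s (indVec X) = ∑ i ∈ X, s i := by
  simp [inner_eq_sum, indVec]

theorem exists_perm_prefixSet {Y X : Finset (Fin d)} (h : Y ⊆ X) :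
    ∃ σ : Equiv.Perm (Fin d), ∃ j ≤ d, ∃ k ≤ d, Y = prefixSet σ j ∧ X = prefixSet σ k := by
  set w : E d := indVec X + indVec Y with hw
  have hwi : ∀ i, w i = (if i ∈ X then 1 else 0) + (if i ∈ Y then 1 else 0) := fun i => by
    simp [hw, indVec]
  have hσ := isDecreasingOrder_decOrder w
  obtain ⟨j, hj, hYj⟩ := exists_prefixSet_eq (A := Y) hσ 1 (fun i => by
    rw [hwi]
    by_cases hY : i ∈ Y
    · simp [hY, h hY]
    · by_cases hX : i ∈ X <;> simp [hY, hX])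
  obtain ⟨k, hk, hXk⟩ := exists_prefixSet_eq (A := X) hσ 0 (fun i => by
    rw [hwi]
    by_cases hX : i ∈ X
    · by_cases hY : i ∈ Y <;> simp [hY, hX]
    · have hY : i ∉ Y := fun hY => hX (h hY)
      simp [hX, hY])
  exact ⟨_, j, hj, k, hk, hYj, hXk⟩

theorem lovasz_indVec {F : Finset (Fin d) → ℝ} (hF : Normalized F) (hFs : Submodular F)
    (X : Finset (Fin d)) : lovasz F (indVec X) = F X := by
  apply le_antisymm
  · rw [lovasz_eq_inner, inner_indVec]
    exact sum_greedy_le hF hFs _ _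
  · obtain ⟨σ, -, -, k, hk, -, hX⟩ := exists_perm_prefixSet (subset_refl X)
    have h := inner_greedy_le_lovasz hF hFs σ (indVec X)
    rw [inner_indVec] at h
    nth_rewrite 1 [hX] at h
    rwa [sum_greedy_prefixSet hF σ hk, ← hX] at h

/-- Rounding a point of the cube does not increase the value of the Lovász extension. This holds
for a difference of submodular functions, which need not be submodular. -/
theorem IsRound.le_lovasz {G H : Finset (Fin d) → ℝ} (hG : Normalized G) (hGs : Submodular G)
    (hH : Normalized H) (hHs : Submodular H) {x : E d} (hx : ∀ i, 0 ≤ x i ∧ x i ≤ 1)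
    {X : Finset (Fin d)} (hX : IsRound (G - H) x X) : (G - H) X ≤ lovasz G x - lovasz H x := by
  obtain ⟨σ, hσ, k, -, rfl, hmin⟩ := hX
  set m := (G - H) (prefixSet σ k)
  have h := le_sum_mul_sub (fun k => x (σ k)) hσ (fun j => (G - H) (prefixSet σ j) - m)
    (fun j hj => sub_nonneg.2 (hmin j hj)) zero_le_one (fun i => (hx _).1) (fun i => (hx _).2)
  have h0 : (G - H) ∅ = 0 := by
    rw [Pi.sub_apply, hG, hH, sub_zero]
  rw [← inner_greedy_eq_lovasz hG hGs hσ, ← inner_greedy_eq_lovasz hH hHs hσ, inner_greedy,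
    inner_greedy, ← Finset.sum_sub_distrib]
  rw [prefixSet_zero, h0] at h
  refine le_trans (by linarith) (h.trans_eq (Finset.sum_congr rfl fun j _ => ?_))
  rw [prefixSet_succ]
  simp only [marginal, Pi.sub_apply]
  ring

/-! ### The two components of the program as real functions -/

/-- The real function `F_L + (ρ/2) ‖·‖²`; it is `h` for `F = H`, and it agrees with `g` on the cube
for `F = G`. -/
noncomputable def regLovasz (F : Finset (Fin d) → ℝ) (ρ : ℝ) (x : E d) : ℝ :=
  lovasz F x + ρ / 2 * ‖x‖ ^ 2

/-- The cube `[0,1]^d`. -/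
def cube (d : ℕ) : Set (E d) := {x | ∀ i, 0 ≤ x i ∧ x i ≤ 1}

theorem indVec_mem_cube (X : Finset (Fin d)) : indVec X ∈ cube d := by
  intro i
  by_cases h : i ∈ X <;> simp [indVec, h]

theorem segment_mem_cube {x z : E d} (hx : x ∈ cube d) (hz : z ∈ cube d) {t : ℝ} (ht : 0 ≤ t)
    (ht' : t ≤ 1) : x + t • (z - x) ∈ cube d := by
  intro i
  have h1 := hx i
  have h2 := hz i
  simp only [PiLp.add_apply, PiLp.smul_apply, PiLp.sub_apply, smul_eq_mul]
  constructor <;> nlinarith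

theorem gFun_of_mem (G : Finset (Fin d) → ℝ) (ρ : ℝ) {x : E d} (hx : x ∈ cube d) :
    gFun G ρ x = (regLovasz G ρ x : EReal) := by
  rw [gFun, boxInd, if_pos (show ∀ i, 0 ≤ x i ∧ x i ≤ 1 from hx), add_zero, regLovasz, EReal.coe_add]

theorem gFun_of_notMem (G : Finset (Fin d) → ℝ) (ρ : ℝ) {x : E d} (hx : x ∉ cube d) :
    gFun G ρ x = ⊤ := by
  rw [gFun, boxInd, if_neg (show ¬∀ i, 0 ≤ x i ∧ x i ≤ 1 from hx), EReal.coe_add_top, EReal.top_add_coe]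

theorem hFun_eq (H : Finset (Fin d) → ℝ) (ρ : ℝ) (x : E d) :
    hFun H ρ x = (regLovasz H ρ x : EReal) := by
  rw [hFun, regLovasz, EReal.coe_add]

theorem mem_subdiff_hFun {H : Finset (Fin d) → ℝ} {ρ ε : ℝ} {x y : E d} :
    y ∈ subdiff ε (hFun H ρ) x ↔
      ∀ z, regLovasz H ρ x + (inner ℝ y (z - x) - ε) ≤ regLovasz H ρ z := by
  simp only [subdiff, hFun_eq, Set.mem_ofPred_eq]
  constructor
  · intro h z
    exact_mod_cast h.2 z
  · intro h
    exact ⟨EReal.coe_ne_top _, fun z => by exact_mod_cast h z⟩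

theorem mem_subdiff_gFun {G : Finset (Fin d) → ℝ} {ρ ε : ℝ} {x y : E d} :
    y ∈ subdiff ε (gFun G ρ) x ↔ x ∈ cube d ∧
      ∀ z ∈ cube d, regLovasz G ρ x + (inner ℝ y (z - x) - ε) ≤ regLovasz G ρ z := by
  simp only [subdiff, Set.mem_ofPred_eq]
  constructor
  · rintro ⟨hx, h⟩
    have hx' : x ∈ cube d := by
      by_contra hx'
      exact hx (gFun_of_notMem G ρ hx')
    refine ⟨hx', fun z hz => ?_⟩
    have := h z
    rw [gFun_of_mem G ρ hx', gFun_of_mem G ρ hz] at this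
    exact_mod_cast this
  · rintro ⟨hx, h⟩
    rw [gFun_of_mem G ρ hx]
    refine ⟨EReal.coe_ne_top _, fun z => ?_⟩
    by_cases hz : z ∈ cube d
    · rw [gFun_of_mem G ρ hz]
      exact_mod_cast h z hz
    · rw [gFun_of_notMem G ρ hz]
      exact le_top

/-! ### Strong convexity -/

theorem norm_segment_sq (x z : E d) (t : ℝ) : ‖x + t • (z - x)‖ ^ 2 =
    (1 - t) * ‖x‖ ^ 2 + t * ‖z‖ ^ 2 - t * (1 - t) * ‖x - z‖ ^ 2 := by
  simp only [← real_inner_self_eq_norm_sq, inner_add_left, inner_add_right, inner_sub_left,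
    inner_sub_right, real_inner_smul_left, real_inner_smul_right, real_inner_comm x z]
  ring

theorem regLovasz_strongConvex {F : Finset (Fin d) → ℝ} (hF : Normalized F) (hFs : Submodular F)
    (ρ : ℝ) (x z : E d) {t : ℝ} (ht : 0 ≤ t) (ht' : t ≤ 1) :
    regLovasz F ρ (x + t • (z - x)) ≤ (1 - t) * regLovasz F ρ x + t * regLovasz F ρ z
      - ρ / 2 * (t * (1 - t) * ‖x - z‖ ^ 2) := by
  have h := lovasz_convex hF hFs x z ht ht'
  simp only [regLovasz]
  rw [norm_segment_sq]
  linarith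

/-- An approximate subgradient inequality that holds along the segment from `x` to `z` gains a
quadratic term from strong convexity. -/
theorem growth_of_segment {F : Finset (Fin d) → ℝ} (hF : Normalized F) (hFs : Submodular F)
    {ρ ε : ℝ} {x y z : E d} {t : ℝ} (ht : 0 < t) (ht' : t ≤ 1)
    (h : regLovasz F ρ x + (inner ℝ y (x + t • (z - x) - x) - ε) ≤
      regLovasz F ρ (x + t • (z - x))) :
    ρ * (1 - t) / 2 * ‖x - z‖ ^ 2 - ε / t ≤
      regLovasz F ρ z - regLovasz F ρ x - inner ℝ y (z - x) := by
  have hc := regLovasz_strongConvex hF hFs ρ x z ht.le ht'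
  rw [add_sub_cancel_left, real_inner_smul_right] at h
  refine le_of_mul_le_mul_left ?_ ht
  rw [mul_sub, mul_div_cancel₀ _ ht.ne']
  linarith

theorem growth_of_subgradient {F : Finset (Fin d) → ℝ} (hF : Normalized F) (hFs : Submodular F)
    {ρ : ℝ} {x y z : E d} (h : y ∈ subdiff 0 (hFun F ρ) x) :
    ρ / 2 * ‖x - z‖ ^ 2 ≤ regLovasz F ρ z - regLovasz F ρ x - inner ℝ y (z - x) := by
  have hlim : Filter.Tendsto (fun t : ℝ => ρ * (1 - t) / 2 * ‖x - z‖ ^ 2)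
      (nhdsWithin 0 (Set.Ioi 0)) (nhds (ρ / 2 * ‖x - z‖ ^ 2)) := by
    have hcont : Continuous fun t : ℝ => ρ * (1 - t) / 2 * ‖x - z‖ ^ 2 := by fun_prop
    have := hcont.tendsto 0
    rw [sub_zero, mul_one] at this
    exact this.mono_left nhdsWithin_le_nhds
  refine le_of_tendsto hlim ?_
  filter_upwards [Ioc_mem_nhdsGT (zero_lt_one' ℝ)] with t ht
  have := growth_of_segment hF hFs ht.1 ht.2 (mem_subdiff_hFun.1 h (x + t • (z - x)))
  simpa using this

/-! ### Conjugates -/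

theorem greedy_add_mem_subdiff {F : Finset (Fin d) → ℝ} (hF : Normalized F) (hFs : Submodular F)
    {ρ : ℝ} (hρ : 0 ≤ ρ) {σ : Equiv.Perm (Fin d)} {x : E d}
    (hσ : inner ℝ (greedy F σ) x = lovasz F x) :
    greedy F σ + ρ • x ∈ subdiff 0 (hFun F ρ) x := by
  rw [mem_subdiff_hFun]
  intro z
  have h := inner_greedy_le_lovasz hF hFs σ z
  have h2 := mul_nonneg hρ (sq_nonneg ‖z - x‖)
  rw [norm_sub_sq_real, real_inner_comm] at h2
  simp only [regLovasz, inner_add_left, inner_sub_right, real_inner_smul_left,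
    real_inner_self_eq_norm_sq, hσ]
  linarith

theorem inner_le_sum_abs (y : E d) {z : E d} (hz : z ∈ cube d) : inner ℝ y z ≤ ∑ i, |y i| := by
  rw [inner_eq_sum]
  refine Finset.sum_le_sum fun i _ => ?_
  calc y i * z i ≤ |y i| * z i := mul_le_mul_of_nonneg_right (le_abs_self _) (hz i).1
    _ ≤ |y i| := mul_le_of_le_one_right (abs_nonneg _) (hz i).2

theorem conj_gFun_le_iff {G : Finset (Fin d) → ℝ} {ρ : ℝ} {y : E d} {b : ℝ} :
    conj (gFun G ρ) y ≤ (b : EReal) ↔ ∀ z ∈ cube d, inner ℝ z y - regLovasz G ρ z ≤ b := by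
  rw [conj, iSup_le_iff]
  constructor
  · intro h z hz
    have := h z
    rw [gFun_of_mem G ρ hz] at this
    exact_mod_cast this
  · intro h z
    by_cases hz : z ∈ cube d
    · rw [gFun_of_mem G ρ hz]
      exact_mod_cast h z hz
    · rw [gFun_of_notMem G ρ hz, EReal.sub_top]
      exact bot_le

theorem exists_conj_gFun_eq {G : Finset (Fin d) → ℝ} (hG : Normalized G) (hGs : Submodular G)
    {ρ : ℝ} (hρ : 0 ≤ ρ) (y : E d) : ∃ c : ℝ, conj (gFun G ρ) y = (c : EReal) := by
  have hub : conj (gFun G ρ) y ≤ ((∑ i, |(y - greedy G 1) i| : ℝ) : EReal) := by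
    refine conj_gFun_le_iff.2 fun z hz => ?_
    have h1 := inner_greedy_le_lovasz hG hGs 1 z
    have h2 := inner_le_sum_abs (y - greedy G 1) hz
    have h3 : 0 ≤ ρ / 2 * ‖z‖ ^ 2 := by positivity
    rw [inner_sub_left] at h2
    rw [regLovasz, real_inner_comm]
    linarith
  have hlb : (⊥ : EReal) < conj (gFun G ρ) y := by
    refine lt_of_lt_of_le ?_ (le_iSup _ (indVec ∅))
    rw [gFun_of_mem G ρ (indVec_mem_cube ∅), ← EReal.coe_sub]
    exact EReal.bot_lt_coe _
  exact ⟨_, (EReal.coe_toReal (hub.trans_lt (EReal.coe_lt_top _)).ne hlb.ne').symm⟩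

/-- Since `h` is finite, a subgradient of `h` attains equality in the Fenchel inequality. -/
theorem conj_hFun_eq {H : Finset (Fin d) → ℝ} {ρ : ℝ} {x y : E d}
    (h : y ∈ subdiff 0 (hFun H ρ) x) :
    conj (hFun H ρ) y = ((inner ℝ x y - regLovasz H ρ x : ℝ) : EReal) := by
  rw [mem_subdiff_hFun] at h
  apply le_antisymm
  · refine iSup_le fun z => ?_
    rw [hFun_eq, ← EReal.coe_sub, EReal.coe_le_coe_iff]
    have := h z
    rw [inner_sub_right, real_inner_comm z, real_inner_comm x] at this
    linarith
  · refine le_trans (le_of_eq ?_) (le_iSup _ x)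
    rw [hFun_eq, ← EReal.coe_sub]

/-- Approximate subgradients of `g` are the points of approximate equality in the Fenchel
inequality. -/
theorem mem_subdiff_gFun_iff_conj {G : Finset (Fin d) → ℝ} {ρ ε c : ℝ} {x y : E d}
    (hc : conj (gFun G ρ) y = (c : EReal)) :
    y ∈ subdiff ε (gFun G ρ) x ↔ x ∈ cube d ∧ regLovasz G ρ x + c ≤ inner ℝ x y + ε := by
  have key : c ≤ inner ℝ x y + ε - regLovasz G ρ x ↔
      ∀ z ∈ cube d, inner ℝ z y - regLovasz G ρ z ≤ inner ℝ x y + ε - regLovasz G ρ x := by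
    rw [← conj_gFun_le_iff, hc, EReal.coe_le_coe_iff]
  rw [mem_subdiff_gFun, ← le_sub_iff_add_le', key]
  refine and_congr_right fun _ => forall₂_congr fun z _ => ?_
  rw [inner_sub_right, real_inner_comm z, real_inner_comm x]
  constructor <;> intro h <;> linarith

/-- A point at which `⟨x, ·⟩ - g^*` is bounded above lies in the cube: along a coordinate direction
`g^*` grows at most like the support function of the cube. -/
theorem mem_cube_of_conj_bound {G : Finset (Fin d) → ℝ} (hG : Normalized G) (hGs : Submodular G)
    {ρ : ℝ} (hρ : 0 ≤ ρ) {x : E d} {b : ℝ}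
    (h : ∀ w, ((inner ℝ x w - b : ℝ) : EReal) ≤ conj (gFun G ρ) w) : x ∈ cube d := by
  obtain ⟨c, hc⟩ := exists_conj_gFun_eq hG hGs hρ 0
  have hc0 := conj_gFun_le_iff.1 hc.le
  have key : ∀ (i : Fin d) (M u : ℝ), (∀ z ∈ cube d, M * z i ≤ u) → M * x i - b ≤ c + u := by
    intro i M u hu
    have hle : conj (gFun G ρ) (EuclideanSpace.single i M) ≤ ((c + u : ℝ) : EReal) := by
      refine conj_gFun_le_iff.2 fun z hz => ?_
      have h1 := hc0 z hz
      have h2 := hu z hz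
      rw [inner_zero_right] at h1
      rw [EuclideanSpace.inner_single_right]
      simp only [conj_trivial]
      linarith
    have := (h _).trans hle
    rw [EuclideanSpace.inner_single_right, EReal.coe_le_coe_iff] at this
    simpa using this
  intro i
  constructor
  · by_contra! hneg
    have hlim : Filter.Tendsto (fun M : ℝ => M * -x i) Filter.atTop Filter.atTop :=
      Filter.tendsto_id.atTop_mul_const (neg_pos.2 hneg)
    obtain ⟨M, hM, hM0⟩ := ((hlim.eventually_gt_atTop (b + c)).and
      (Filter.eventually_ge_atTop 0)).exists
    have := key i (-M) 0 fun z hz => by nlinarith [(hz i).1]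
    linarith
  · by_contra! hgt
    have hlim : Filter.Tendsto (fun M : ℝ => M * (x i - 1)) Filter.atTop Filter.atTop :=
      Filter.tendsto_id.atTop_mul_const (sub_pos.2 hgt)
    obtain ⟨M, hM, hM0⟩ := ((hlim.eventually_gt_atTop (b + c)).and
      (Filter.eventually_ge_atTop 0)).exists
    have := key i M M fun z hz => mul_le_of_le_one_right hM0 (hz i).2
    linarith

/-- Inversion of approximate subdifferentials: `x ∈ ∂_ε g^*(y)` implies `y ∈ ∂_ε g(x)`. The explicit
subgradients of `g` on the cube replace the Fenchel–Moreau theorem. -/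
theorem mem_subdiff_of_mem_subdiff_conj {G : Finset (Fin d) → ℝ} (hG : Normalized G)
    (hGs : Submodular G) {ρ ε : ℝ} (hρ : 0 ≤ ρ) {x y : E d}
    (h : x ∈ subdiff ε (conj (gFun G ρ)) y) : y ∈ subdiff ε (gFun G ρ) x := by
  obtain ⟨c, hc⟩ := exists_conj_gFun_eq hG hGs hρ y
  have h2 := h.2
  rw [hc] at h2
  have hx : x ∈ cube d := by
    refine mem_cube_of_conj_bound hG hGs hρ (b := inner ℝ x y + ε - c) fun w => ?_
    refine le_trans (le_of_eq ?_) (h2 w)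
    rw [← EReal.coe_add, inner_sub_right]
    congr 1
    ring
  refine (mem_subdiff_gFun_iff_conj hc).2 ⟨hx, ?_⟩
  set s := greedy G (decOrder x) + ρ • x
  have hs : s ∈ subdiff 0 (gFun G ρ) x := by
    have := greedy_add_mem_subdiff hG hGs hρ (lovasz_eq_inner G x).symm
    exact mem_subdiff_gFun.2 ⟨hx, fun z _ => mem_subdiff_hFun.1 this z⟩
  obtain ⟨cs, hcs⟩ := exists_conj_gFun_eq hG hGs hρ s
  have h3 := ((mem_subdiff_gFun_iff_conj hcs).1 hs).2
  have h4 := h2 s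
  rw [hcs, ← EReal.coe_add, EReal.coe_le_coe_iff, inner_sub_right] at h4
  linarith

/-! ### Strong critical points and strong local minima -/

theorem le_epsPrime {ρ ε a : ℝ} (hε : 0 ≤ ε)
    (h : ∀ τ, 0 < τ → τ ≤ 1 → a ≤ ρ * d / 2 * τ + ε / τ) : a ≤ epsPrime ρ d ε := by
  rw [epsPrime]
  split_ifs with hle
  · rcases hε.eq_or_lt with rfl | hpos
    · rw [mul_zero, Real.sqrt_zero]
      have hlim : Filter.Tendsto (fun τ : ℝ => ρ * d / 2 * τ)
          (nhdsWithin 0 (Set.Ioi 0)) (nhds 0) := by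
        have hcont : Continuous fun τ : ℝ => ρ * d / 2 * τ := by fun_prop
        have := hcont.tendsto 0
        rw [mul_zero] at this
        exact this.mono_left nhdsWithin_le_nhds
      refine ge_of_tendsto hlim ?_
      filter_upwards [Ioc_mem_nhdsGT (zero_lt_one' ℝ)] with τ hτ
      simpa using h τ hτ.1 hτ.2
    · have hM : 0 < ρ * d := by linarith
      set q := √(2 * ρ * d * ε) with hq
      have hq0 : 0 < q := Real.sqrt_pos.2 (by nlinarith)
      have hq2 : q ^ 2 = 2 * ρ * d * ε := Real.sq_sqrt (by nlinarith)
      -- `τ = √(2ε / (ρd))` minimizes the bound.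
      have h1 : q / (ρ * d) ≤ 1 := by
        rw [div_le_one hM]
        refine abs_le_of_sq_le_sq' ?_ hM.le |>.2
        nlinarith
      have h2 : ε / (q / (ρ * d)) = q / 2 := by
        rw [div_div_eq_mul_div, div_eq_iff hq0.ne']
        linarith
      have h3 : ρ * d / 2 * (q / (ρ * d)) = q / 2 := by
        rw [div_mul_div_comm, mul_comm (2 : ℝ), mul_div_mul_left _ _ hM.ne']
      refine (h _ (div_pos hq0 hM) h1).trans_eq ?_
      rw [h2, h3, add_halves]
  · simpa using h 1 one_pos le_rfl

theorem norm_indVec_sub_sq_le (X Y : Finset (Fin d)) : ‖indVec X - indVec Y‖ ^ 2 ≤ d := by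
  rw [EuclideanSpace.norm_sq_eq]
  calc ∑ i, ‖(indVec X - indVec Y) i‖ ^ 2 ≤ ∑ _i : Fin d, (1 : ℝ) := by
        refine Finset.sum_le_sum fun i _ => ?_
        by_cases hX : i ∈ X <;> by_cases hY : i ∈ Y <;> simp [indVec, hX, hY]
    _ = d := by simp

/-- The greedy vector of an order in which both `X` and `Y` are prefixes is a subgradient of `h_L`
at `𝟙_X` that is exact at `𝟙_Y`. -/
theorem IsStrongCritical.le_add_epsPrime {G H : Finset (Fin d) → ℝ} (hG : Normalized G)
    (hGs : Submodular G) (hH : Normalized H) (hHs : Submodular H) {ρ ε : ℝ} (hρ : 0 ≤ ρ)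
    (hε : 0 ≤ ε) {X Y : Finset (Fin d)}
    (hcrit : IsStrongCritical (gFun G ρ) (hFun H ρ) ε (indVec X))
    {σ : Equiv.Perm (Fin d)} (hX : ∃ k ≤ d, X = prefixSet σ k)
    (hY : ∃ k ≤ d, Y = prefixSet σ k) : (G - H) X ≤ (G - H) Y + epsPrime ρ d ε := by
  have hval : ∀ Z : Finset (Fin d), (∃ k ≤ d, Z = prefixSet σ k) →
      inner ℝ (greedy H σ) (indVec Z) = H Z := by
    rintro _ ⟨k, hk, rfl⟩
    rw [inner_indVec, sum_greedy_prefixSet hH σ hk]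
  have hs := greedy_add_mem_subdiff hH hHs hρ
    ((hval X hX).trans (lovasz_indVec hH hHs X).symm)
  obtain ⟨hxc, hg⟩ := mem_subdiff_gFun.1 (hcrit hs)
  rw [← sub_le_iff_le_add']
  refine le_epsPrime hε fun τ hτ hτ1 => ?_
  have h1 := hg _ (segment_mem_cube hxc (indVec_mem_cube Y) hτ.le hτ1)
  have h2 := lovasz_convex hG hGs (indVec X) (indVec Y) hτ.le hτ1
  have h3 := mul_le_mul_of_nonneg_left (norm_indVec_sub_sq_le Y X)
    (mul_nonneg hρ (sq_nonneg τ))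
  rw [add_sub_cancel_left, inner_smul_right, inner_add_left, inner_sub_right, hval X hX, hval Y hY,
    real_inner_smul_left] at h1
  simp only [regLovasz] at h1
  rw [norm_add_sq_real, norm_smul, Real.norm_of_nonneg hτ.le, inner_smul_right] at h1
  rw [lovasz_indVec hG hGs] at h1 h2
  rw [lovasz_indVec hG hGs] at h2
  refine le_of_mul_le_mul_left ?_ hτ
  rw [mul_add, mul_div_cancel₀ _ hτ.ne', Pi.sub_apply, Pi.sub_apply]
  linarith

theorem IsStrongCritical.isStrongLocalMin {G H : Finset (Fin d) → ℝ} (hG : Normalized G)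
    (hGs : Submodular G) (hH : Normalized H) (hHs : Submodular H) {ρ ε : ℝ} (hρ : 0 ≤ ρ)
    (hε : 0 ≤ ε) {X : Finset (Fin d)}
    (hcrit : IsStrongCritical (gFun G ρ) (hFun H ρ) ε (indVec X)) :
    IsStrongLocalMin (G - H) (epsPrime ρ d ε) X := by
  constructor <;> intro Y hY <;> obtain ⟨σ, j, hj, k, hk, hYj, hXk⟩ := exists_perm_prefixSet hY
  · exact hcrit.le_add_epsPrime hG hGs hH hHs hρ hε ⟨k, hk, hXk⟩ ⟨j, hj, hYj⟩
  · exact hcrit.le_add_epsPrime hG hGs hH hHs hρ hε ⟨j, hj, hYj⟩ ⟨k, hk, hXk⟩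

/-! ### One iteration -/

/-- The real value of `gapT` for the regularized Lovász extension of `F`. -/
noncomputable def gap (F : Finset (Fin d) → ℝ) (ρ : ℝ) (y x x' : E d) : ℝ :=
  regLovasz F ρ x - regLovasz F ρ x' - inner ℝ y (x - x')

theorem gapT_gFun (G : Finset (Fin d) → ℝ) (ρ : ℝ) (y : E d) {x x' : E d} (hx : x ∈ cube d)
    (hx' : x' ∈ cube d) : gapT (gFun G ρ) y x x' = (gap G ρ y x x' : EReal) := by
  rw [gapT, gFun_of_mem G ρ hx, gFun_of_mem G ρ hx', ← EReal.coe_sub, ← EReal.coe_sub, gap]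

theorem gapT_hFun (H : Finset (Fin d) → ℝ) (ρ : ℝ) (y x x' : E d) :
    gapT (hFun H ρ) y x x' = (gap H ρ y x x' : EReal) := by
  rw [gapT, hFun_eq, hFun_eq, ← EReal.coe_sub, ← EReal.coe_sub, gap]

theorem fFun_of_mem (G H : Finset (Fin d) → ℝ) (ρ : ℝ) {x : E d} (hx : x ∈ cube d) :
    fFun G H ρ x = ((lovasz G x - lovasz H x : ℝ) : EReal) := by
  rw [fFun, gFun_of_mem G ρ hx, hFun_eq, ← EReal.coe_sub, regLovasz, regLovasz,
    add_sub_add_right_eq_sub]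

/-- The regularization and the linear terms cancel. -/
theorem gap_sub_gap (G H : Finset (Fin d) → ℝ) (ρ : ℝ) (y x x' : E d) :
    gap G ρ y x x' - gap H ρ y x x' =
      (lovasz G x - lovasz H x) - (lovasz G x' - lovasz H x') := by
  simp only [gap, regLovasz]
  ring

theorem le_gap_of_mem_subdiff {G : Finset (Fin d) → ℝ} (hG : Normalized G) (hGs : Submodular G)
    {ρ ε : ℝ} {y x x' : E d} (hx : x ∈ cube d) (h : y ∈ subdiff ε (gFun G ρ) x') {t : ℝ}
    (ht : 0 < t) (ht' : t ≤ 1) :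
    ρ * (1 - t) / 2 * ‖x - x'‖ ^ 2 - ε / t ≤ gap G ρ y x x' := by
  obtain ⟨hx', h⟩ := mem_subdiff_gFun.1 h
  have := growth_of_segment hG hGs ht ht' (h _ (segment_mem_cube hx' hx ht.le ht'))
  rwa [norm_sub_rev] at this

theorem gap_le_of_mem_subdiff {H : Finset (Fin d) → ℝ} (hH : Normalized H) (hHs : Submodular H)
    {ρ : ℝ} {y x x' : E d} (h : y ∈ subdiff 0 (hFun H ρ) x) :
    gap H ρ y x x' ≤ -(ρ / 2 * ‖x - x'‖ ^ 2) := by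
  have := growth_of_subgradient hH hHs h (z := x')
  rw [← neg_sub x x', inner_neg_right] at this
  rw [gap]
  linarith

theorem mem_subdiff_of_gap_le {G : Finset (Fin d) → ℝ} {ρ ε ε' : ℝ} {y x x' : E d}
    (hx : x ∈ cube d) (h : y ∈ subdiff ε' (gFun G ρ) x') (hgap : gap G ρ y x x' ≤ ε) :
    y ∈ subdiff (ε + ε') (gFun G ρ) x := by
  refine mem_subdiff_gFun.2 ⟨hx, fun z hz => ?_⟩
  have := (mem_subdiff_gFun.1 h).2 z hz
  simp only [gap, inner_sub_right] at *
  linarith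

theorem gap_le_of_mem_subdiff_conj {G : Finset (Fin d) → ℝ} (hG : Normalized G)
    (hGs : Submodular G) {ρ ε : ℝ} (hρ : 0 ≤ ρ) {y x x' : E d} (hx' : x' ∈ cube d)
    (h : x ∈ subdiff ε (conj (gFun G ρ)) y) : gap G ρ y x x' ≤ ε := by
  have := (mem_subdiff_gFun.1 (mem_subdiff_of_mem_subdiff_conj hG hGs hρ h)).2 x' hx'
  simp only [gap, inner_sub_right] at *
  linarith

theorem mem_subdiff_of_neg_le_gap {H : Finset (Fin d) → ℝ} {ρ ε : ℝ} {y x x' : E d}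
    (h : y ∈ subdiff 0 (hFun H ρ) x) (hgap : -ε ≤ gap H ρ y x x') :
    y ∈ subdiff ε (hFun H ρ) x' := by
  refine mem_subdiff_hFun.2 fun z => ?_
  have := mem_subdiff_hFun.1 h z
  simp only [gap, inner_sub_right] at *
  linarith

theorem neg_le_gap_of_mem_subdiff {H : Finset (Fin d) → ℝ} {ρ ε : ℝ} {y x x' : E d}
    (h : y ∈ subdiff ε (hFun H ρ) x') : -ε ≤ gap H ρ y x x' := by
  have := mem_subdiff_hFun.1 h x
  simp only [gap, inner_sub_right] at *
  linarith

/-- On `∂h(x)` one has `h^* = ⟨x, ·⟩ - h(x)`, so minimizing `h^* - g^*` there means maximizing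
`g^* - ⟨x, ·⟩`, the gap in the Fenchel inequality for `g` at `x`. An approximate subgradient of `g`
with the largest gap turns every other element of `∂h(x)` into one. -/
theorem isStrongCritical_of_isMin {G H : Finset (Fin d) → ℝ} (hG : Normalized G)
    (hGs : Submodular G) {ρ ε : ℝ} (hρ : 0 ≤ ρ) {x y : E d}
    (hyh : y ∈ subdiff 0 (hFun H ρ) x) (hyg : y ∈ subdiff ε (gFun G ρ) x)
    (hmin : ∀ z ∈ subdiff 0 (hFun H ρ) x,
      conj (hFun H ρ) y - conj (gFun G ρ) y ≤ conj (hFun H ρ) z - conj (gFun G ρ) z) :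
    IsStrongCritical (gFun G ρ) (hFun H ρ) ε x := by
  intro z hz
  obtain ⟨cy, hcy⟩ := exists_conj_gFun_eq hG hGs hρ y
  obtain ⟨cz, hcz⟩ := exists_conj_gFun_eq hG hGs hρ z
  have h := hmin z hz
  rw [conj_hFun_eq hyh, conj_hFun_eq hz, hcy, hcz, ← EReal.coe_sub, ← EReal.coe_sub,
    EReal.coe_le_coe_iff] at h
  obtain ⟨hx, h2⟩ := (mem_subdiff_gFun_iff_conj hcy).1 hyg
  exact (mem_subdiff_gFun_iff_conj hcz).2 ⟨hx, by linarith⟩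

/-! ### Telescoping -/

theorem minVal_le (F : Finset (Fin d) → ℝ) (X : Finset (Fin d)) : minVal F ≤ F X :=
  Finset.inf'_le _ (Finset.mem_univ X)

theorem sum_decrease_le (F : Finset (Fin d) → ℝ) (X : ℕ → Finset (Fin d)) (K : ℕ) :
    ∑ k ∈ Finset.range K, (F (X k) - F (X (k + 1))) ≤ F (X 0) - minVal F := by
  rw [Finset.sum_range_sub' fun k => F (X k)]
  linarith [minVal_le F (X K)]

theorem inf'_decrease_le (F : Finset (Fin d) → ℝ) (X : ℕ → Finset (Fin d)) {K : ℕ}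
    (hK : (Finset.range K).Nonempty) :
    (Finset.range K).inf' hK (fun k => F (X k) - F (X (k + 1))) ≤ (F (X 0) - minVal F) / K := by
  have hK0 : (0 : ℝ) < K := Nat.cast_pos.2 (Finset.nonempty_range_iff.1 hK).bot_lt
  rw [le_div_iff₀ hK0]
  refine le_trans ?_ (sum_decrease_le F X K)
  rw [mul_comm, ← nsmul_eq_mul]
  nth_rewrite 1 [← Finset.card_range K]
  exact Finset.card_nsmul_le_sum _ _ _ fun k hk => Finset.inf'_le _ hk

theorem exists_first_small_decrease (F : Finset (Fin d) → ℝ) (X : ℕ → Finset (Fin d)) {ε : ℝ}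
    (hε : 0 < ε) : ∃ k : ℕ, (k : ℝ) ≤ (F (X 0) - minVal F) / ε ∧
      (∀ j < k, ε < F (X j) - F (X (j + 1))) ∧ F (X k) - F (X (k + 1)) ≤ ε := by
  have hbound : ∀ k : ℕ, (∀ j < k, ε < F (X j) - F (X (j + 1))) →
      (k : ℝ) ≤ (F (X 0) - minVal F) / ε := by
    intro k hk
    rw [le_div_iff₀ hε]
    refine le_trans ?_ (sum_decrease_le F X k)
    rw [← nsmul_eq_mul]
    nth_rewrite 1 [← Finset.card_range k]
    exact Finset.card_nsmul_le_sum _ _ _ fun j hj => (hk j (Finset.mem_range.1 hj)).le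
  have hex : ∃ k, F (X k) - F (X (k + 1)) ≤ ε := by
    by_contra! hno
    obtain ⟨K, hK⟩ := exists_nat_gt ((F (X 0) - minVal F) / ε)
    exact (hbound K fun j _ => hno j).not_gt hK
  classical
  have hlt : ∀ j < Nat.find hex, ε < F (X j) - F (X (j + 1)) := fun j hj =>
    not_le.1 (Nat.find_min hex hj)
  exact ⟨Nat.find hex, hbound _ hlt, hlt, Nat.find_spec hex⟩

end DSMin

/-! ### Assembly of the estimates -/

theorem corollary4 (d : ℕ) (G H F : Finset (Fin d) → ℝ)
    (hG : Normalized G) (hGs : Submodular G) (hH : Normalized H) (hHs : Submodular H)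
    (hF : F = G - H) (ρ εx : ℝ) (hρ : 0 ≤ ρ) (hεx : 0 ≤ εx)
    (g h f : E d → EReal) (hg : g = gFun G ρ) (hh : h = hFun H ρ) (hf : f = fFun G H ρ)
    (x : ℕ → E d) (X : ℕ → Finset (Fin d)) (xt y : ℕ → E d)
    (hgen : IsCDCAR G H ρ εx x X xt y)
    (Tg Th : ℕ → EReal)
    (hTg : ∀ k, Tg k = gapT g (y k) (x k) (xt (k + 1)))
    (hTh : ∀ k, Th k = gapT h (y k) (x k) (xt (k + 1))) :
    -- (a) bounds on `T_g` and `T_h`, and their relation to criticality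
    (∀ k : ℕ,
      (∀ t : ℝ, 0 < t → t ≤ 1 →
        ((ρ * (1 - t) / 2 * ‖x k - xt (k + 1)‖ ^ 2 - εx / t : ℝ) : EReal) ≤ Tg k) ∧
      Th k ≤ ((-(ρ / 2 * ‖x k - xt (k + 1)‖ ^ 2) : ℝ) : EReal) ∧
      (∀ ε : ℝ, 0 ≤ ε →
        (Tg k ≤ (ε : EReal) →
          IsCritical g h (ε + εx) 0 (x k) ∧
          y k ∈ subdiff (ε + εx) g (x k) ∩ subdiff 0 h (x k) ∧
          ∀ t : ℝ, 0 < t → t ≤ 1 →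
            ρ * (1 - t) / 2 * ‖x k - xt (k + 1)‖ ^ 2 ≤ εx / t + ε) ∧
        (x k ∈ subdiff (ε + εx) (conj g) (y k) → Tg k ≤ ((εx + ε : ℝ) : EReal)) ∧
        (((-ε : ℝ) : EReal) ≤ Th k →
          IsCritical g h εx ε (xt (k + 1)) ∧
          y k ∈ subdiff εx g (xt (k + 1)) ∩ subdiff ε h (xt (k + 1)) ∧
          ρ / 2 * ‖x k - xt (k + 1)‖ ^ 2 ≤ ε) ∧
        (y k ∈ subdiff ε h (xt (k + 1)) → ((-ε : ℝ) : EReal) ≤ Th k))) ∧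
    -- (b) approximate descent
    (∀ k : ℕ,
      f (x k) - f (xt (k + 1)) ≤ ((F (X k) - F (X (k + 1)) : ℝ) : EReal) ∧
      f (x k) - f (xt (k + 1)) = Tg k - Th k ∧
      ∀ t : ℝ, 0 < t → t ≤ 1 →
        ((ρ * (2 - t) / 2 * ‖x k - xt (k + 1)‖ ^ 2 - εx / t : ℝ) : EReal) ≤ Tg k - Th k) ∧
    -- (c) approximate convergence
    (∀ k : ℕ, ∀ ε : ℝ, 0 ≤ ε →
      (F (X k) - F (X (k + 1)) ≤ ε →
        f (x k) - f (xt (k + 1)) = Tg k - Th k ∧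
        Tg k - Th k ≤ (ε : EReal) ∧
        (∃ ε₁ ε₂ : ℝ, ε₁ + ε₂ = ε ∧ -εx ≤ ε₁ ∧ 0 ≤ ε₂ ∧
          IsCritical g h (εx + ε₁) 0 (x k) ∧
          y k ∈ subdiff (εx + ε₁) g (x k) ∩ subdiff 0 h (x k) ∧
          IsCritical g h εx ε₂ (xt (k + 1)) ∧
          y k ∈ subdiff εx g (xt (k + 1)) ∩ subdiff ε₂ h (xt (k + 1))) ∧
        ∀ t : ℝ, 0 < t → t ≤ 1 →
          ρ * (2 - t) / 2 * ‖x k - xt (k + 1)‖ ^ 2 ≤ ε + εx / t) ∧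
      (∀ ε₁ ε₂ : ℝ, ε₁ + ε₂ = ε → -εx ≤ ε₁ → 0 ≤ ε₂ →
        x k ∈ subdiff (εx + ε₁) (conj g) (y k) → y k ∈ subdiff ε₂ h (xt (k + 1)) →
        Tg k - Th k ≤ ((εx + ε : ℝ) : EReal) ∧
        f (x k) - f (xt (k + 1)) ≤ ((εx + ε : ℝ) : EReal))) ∧
    -- (d) rate in objective values
    (∀ (K : ℕ) (hK : (Finset.range K).Nonempty),
      (Finset.range K).inf' hK (fun k => Tg k - Th k) =
        (Finset.range K).inf' hK (fun k => f (x k) - f (xt (k + 1))) ∧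
      (Finset.range K).inf' hK (fun k => f (x k) - f (xt (k + 1))) ≤
        (((Finset.range K).inf' hK (fun k => F (X k) - F (X (k + 1))) : ℝ) : EReal) ∧
      (Finset.range K).inf' hK (fun k => F (X k) - F (X (k + 1))) ≤
        (F (X 0) - minVal F) / K) ∧
    -- (e) rate in iterates
    (0 < ρ → ∀ (K : ℕ) (hK : (Finset.range K).Nonempty) (t : ℝ), 0 < t → t ≤ 1 →
      (Finset.range K).inf' hK (fun k => ‖x k - xt (k + 1)‖) ≤
        √(2 / (ρ * (2 - t)) * ((F (X 0) - minVal F) / K + εx / t))) ∧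
    -- strong criticality and strong local minimality
    (∀ k : ℕ, ∀ ε : ℝ, 0 ≤ ε → F (X k) - F (X (k + 1)) ≤ ε →
      IsStrongCritical g h (ε + εx) (x k) ∧
      IsStrongLocalMin F (epsPrime ρ d (ε + εx)) (X k)) ∧
    -- bound on the number `k` of iterations before the stopping criterion is first met
    (∀ ε : ℝ, 0 < ε → ∃ k : ℕ,
      (k : ℝ) ≤ (F (X 0) - minVal F) / ε ∧
      (∀ j < k, ε < F (X j) - F (X (j + 1))) ∧
      F (X k) - F (X (k + 1)) ≤ ε ∧
      IsStrongLocalMin F (epsPrime ρ d (ε + εx)) (X k)) := by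
  subst hF hg hh hf
  have hyh : ∀ k, y k ∈ subdiff 0 (hFun H ρ) (x k) := hgen.y_mem
  have hyg : ∀ k, y k ∈ subdiff εx (gFun G ρ) (xt (k + 1)) := fun k =>
    mem_subdiff_of_mem_subdiff_conj hG hGs hρ (hgen.xt_mem k)
  have hx : ∀ k, x k ∈ cube d := fun k => hgen.x_eq k ▸ indVec_mem_cube (X k)
  have hxt : ∀ k, xt (k + 1) ∈ cube d := fun k => (mem_subdiff_gFun.1 (hyg k)).1
  set tg : ℕ → ℝ := fun k => gap G ρ (y k) (x k) (xt (k + 1)) with htg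
  set th : ℕ → ℝ := fun k => gap H ρ (y k) (x k) (xt (k + 1)) with hth
  have hTg' : ∀ k, Tg k = (tg k : EReal) := fun k =>
    (hTg k).trans (gapT_gFun G ρ (y k) (hx k) (hxt k))
  have hTh' : ∀ k, Th k = (th k : EReal) := fun k =>
    (hTh k).trans (gapT_hFun H ρ (y k) (x k) (xt (k + 1)))
  have hT : ∀ k, Tg k - Th k = ((tg k - th k : ℝ) : EReal) := fun k => by
    rw [hTg', hTh', EReal.coe_sub]
  have hfT : ∀ k, fFun G H ρ (x k) - fFun G H ρ (xt (k + 1)) = Tg k - Th k := fun k => by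
    rw [hT, fFun_of_mem G H ρ (hx k), fFun_of_mem G H ρ (hxt k), ← EReal.coe_sub, htg, hth,
      gap_sub_gap]
  have hdesc : ∀ k, tg k - th k ≤ (G - H) (X k) - (G - H) (X (k + 1)) := fun k => by
    have hr := (hgen.round k).le_lovasz hG hGs hH hHs (hxt k)
    rw [htg, hth, gap_sub_gap, hgen.x_eq k, lovasz_indVec hG hGs, lovasz_indVec hH hHs]
    exact sub_le_sub_left hr _
  have hgl : ∀ k t, 0 < t → t ≤ 1 →
      ρ * (1 - t) / 2 * ‖x k - xt (k + 1)‖ ^ 2 - εx / t ≤ tg k := fun k t ht ht' =>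
    le_gap_of_mem_subdiff hG hGs (hx k) (hyg k) ht ht'
  have hhl : ∀ k, th k ≤ -(ρ / 2 * ‖x k - xt (k + 1)‖ ^ 2) := fun k =>
    gap_le_of_mem_subdiff hH hHs (hyh k)
  have hgh : ∀ k t, 0 < t → t ≤ 1 →
      ρ * (2 - t) / 2 * ‖x k - xt (k + 1)‖ ^ 2 - εx / t ≤ tg k - th k := fun k t ht ht' => by
    have h1 := hgl k t ht ht'
    have h2 := hhl k
    linarith
  have hh0 : ∀ k, th k ≤ 0 := fun k => (hhl k).trans (neg_nonpos.2 (by positivity))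
  -- `t = 1` in the lower bound on `T_g`
  have hg0 : ∀ k, -εx ≤ tg k := fun k => by simpa using hgl k 1 one_pos le_rfl
  have hcritg : ∀ k ε, tg k ≤ ε →
      y k ∈ subdiff (ε + εx) (gFun G ρ) (x k) ∩ subdiff 0 (hFun H ρ) (x k) := fun k ε h =>
    ⟨mem_subdiff_of_gap_le (hx k) (hyg k) h, hyh k⟩
  have hcrith : ∀ k ε, -ε ≤ th k →
      y k ∈ subdiff εx (gFun G ρ) (xt (k + 1)) ∩ subdiff ε (hFun H ρ) (xt (k + 1)) :=
    fun k ε h => ⟨hyg k, mem_subdiff_of_neg_le_gap (hyh k) h⟩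
  have hstrong : ∀ k ε, 0 ≤ ε → (G - H) (X k) - (G - H) (X (k + 1)) ≤ ε →
      IsStrongCritical (gFun G ρ) (hFun H ρ) (ε + εx) (x k) ∧
      IsStrongLocalMin (G - H) (epsPrime ρ d (ε + εx)) (X k) := by
    intro k ε hε h
    have hle : tg k ≤ ε := by linarith [hdesc k, hh0 k]
    have hs := isStrongCritical_of_isMin hG hGs hρ (hyh k) (hcritg k ε hle).1 (hgen.y_min k)
    refine ⟨hs, ?_⟩
    rw [hgen.x_eq k] at hs
    exact hs.isStrongLocalMin hG hGs hH hHs hρ (add_nonneg hε hεx)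
  refine ⟨fun k => ⟨fun t ht ht' => ?_, ?_, fun ε hε => ⟨fun h => ?_, fun h => ?_, fun h => ?_,
    fun h => ?_⟩⟩, fun k => ⟨?_, hfT k, fun t ht ht' => ?_⟩, fun k ε hε => ⟨fun h => ?_,
    fun ε₁ ε₂ hsum hε₁ hε₂ h1 h2 => ?_⟩, fun K hK => ⟨?_, ?_, ?_⟩, fun hρ0 K hK t ht ht' => ?_,
    hstrong, fun ε hε => ?_⟩
  · rw [hTg', EReal.coe_le_coe_iff]
    exact hgl k t ht ht'
  · rw [hTh', EReal.coe_le_coe_iff]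
    exact hhl k
  · rw [hTg', EReal.coe_le_coe_iff] at h
    refine ⟨⟨_, hcritg k ε h⟩, hcritg k ε h, fun t ht ht' => ?_⟩
    linarith [hgl k t ht ht']
  · rw [hTg', EReal.coe_le_coe_iff, add_comm]
    exact gap_le_of_mem_subdiff_conj hG hGs hρ (hxt k) h
  · rw [hTh', EReal.coe_le_coe_iff] at h
    exact ⟨⟨_, hcrith k ε h⟩, hcrith k ε h, by linarith [hhl k]⟩
  · rw [hTh', EReal.coe_le_coe_iff]
    exact neg_le_gap_of_mem_subdiff h
  · rw [hfT, hT, EReal.coe_le_coe_iff]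
    exact hdesc k
  · rw [hT, EReal.coe_le_coe_iff]
    exact hgh k t ht ht'
  · have hle : tg k - th k ≤ ε := (hdesc k).trans h
    refine ⟨hfT k, by rw [hT, EReal.coe_le_coe_iff]; exact hle, ?_, fun t ht ht' => ?_⟩
    · -- `ε₂ = -T_h` leaves `ε₁ = ε + T_h ≥ T_g ≥ -εx`
      have h1 := hcritg k (ε + th k) (by linarith)
      have h2 := hcrith k (-th k) (by linarith)
      rw [add_comm _ εx] at h1
      exact ⟨ε + th k, -th k, by ring, by linarith [hg0 k], by linarith [hh0 k], ⟨_, h1⟩, h1,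
        ⟨_, h2⟩, h2⟩
    · linarith [hgh k t ht ht']
  · have h3 : tg k ≤ εx + ε₁ := gap_le_of_mem_subdiff_conj hG hGs hρ (hxt k) h1
    have h4 : -ε₂ ≤ th k := neg_le_gap_of_mem_subdiff h2
    rw [hfT, hT, EReal.coe_le_coe_iff]
    exact ⟨by linarith, by linarith⟩
  · simp only [hfT]
  · obtain ⟨j, hj, hmin⟩ := Finset.exists_mem_eq_inf' hK
      fun k => (G - H) (X k) - (G - H) (X (k + 1))
    rw [hmin]
    refine (Finset.inf'_le _ hj).trans ?_
    rw [hfT, hT, EReal.coe_le_coe_iff]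
    exact hdesc j
  · exact inf'_decrease_le (G - H) X hK
  · obtain ⟨j, hj, hmin⟩ := Finset.exists_mem_eq_inf' hK
      fun k => (G - H) (X k) - (G - H) (X (k + 1))
    have hle := inf'_decrease_le (G - H) X hK
    rw [hmin] at hle
    refine (Finset.inf'_le _ hj).trans (Real.le_sqrt_of_sq_le ?_)
    have hpos : 0 < ρ * (2 - t) := mul_pos hρ0 (by linarith)
    rw [div_mul_eq_mul_div, le_div_iff₀ hpos]
    linarith [hgh j t ht ht', hdesc j]
  · obtain ⟨k, hk, hlt, hle⟩ := exists_first_small_decrease (G - H) X hε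
    exact ⟨k, hk, hlt, hle, (hstrong k ε hε.le hle).2⟩
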